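/- **Corollary 15.** For sentences, independence logic and dependence logic are equivalent in expressive power: for every vocabulary $L$ (relation, function and constant symbols, with equality), for every $L$-sentence $\varphi$ of independence logic there is an $L$-sentence $\psi$ of dependence logic such that $M\models\varphi\iff M\models\psi$ for all $L$-structures $M$ (with non-empty domain), and, conversely, for every $L$-sentence $\psi$ of dependence logic there is an $L$-sentence $\varphi$ of independence logic such that $M\models\psi\iff M\models\varphi$ for all $L$-structures $M$. Here a *team* on $M$ with domain $V$ (a finite set of variables) is a set $X$ of assignments $s:V\to M$. Formulas of both logics are built by $\wedge,\vee,\exists x,\forall x$ from first-order atomic formulas and extra atoms, and from the negations of these. The extra atoms are the dependence atoms $=\!(\vec y,\vec x)$ in dependence logic and the independence atoms $\vec y\perp_{\vec x}\vec z$ in independence logic, for all finite sequences of variables $\vec x,\vec y,\vec z$. The semantics is as follows. - $M\models_X\alpha$ for a first-order atomic or negated atomic $\alpha$ iff every $s\in X$ satisfies $\alpha$ in $M$ in the usual sense. - $M\models_X{=}(\vec y,\vec x)$ iff for all $s,s'\in X$: $s(\vec y)=s'(\vec y)$ implies $s(\vec x)=s'(\vec x)$. - $M\models_X\vec y\perp_{\vec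 x}\vec z$ iff for all $s,s'\in X$ with $s(\vec x)=s'(\vec x)$ there is $s''\in X$ with $s''(\vec x)=s(\vec x)$, $s''(\vec y)=s(\vec y)$ and $s''(\vec z)=s'(\vec z)$. - A negated dependence or independence atom is satisfied by the empty team alone. - $M\models_X\varphi\wedge\psi$ iff $M\models_X\varphi$ and $M\models_X\psi$. - $M\models_X\varphi\vee\psi$ iff $X=Y\cup Z$ for some $Y,Z$ with $M\models_Y\varphi$ and $M\models_Z\psi$. - $M\models_X\exists x\,\varphi$ iff there is $F:X\to M$ with $M\models_{X'}\varphi$ for $X'=\{s(F(s)/x):s\in X\}$. - $M\models_X\forall x\,\varphi$ iff $M\models_{X'}\varphi$ for $X'=\{s(a/x):s\in X,\ a\in M\}$. A sentence is a formula without free variables, and for a sentence $\varphi$, $M\models\varphi$ means $M\models_{\{\emptyset\}}\varphi$, where $\emptyset$ is the assignment with empty domain. -/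

import Mathlib

universe u v w

namespace TeamLogic

/-- Formulas in negation normal form over a vocabulary `L`, with named variables `x₀, x₁, …`
(variables are natural numbers), extending first-order logic by extra atoms: `A α` is the type of
extra atoms whose variables come from `α`.  The index `V` is a finite set of variables containing
all free variables of the formula; it is the common domain of the assignments in the teams in
which the formula is evaluated.  Variables may be requantified.  Negation stands in front of
atomic formulas only. -/
inductive Formula (L : FirstOrder.Language.{u, v}) (A : Type → Type) : Finset ℕ → Type (max u v)
  | eq {V : Finset ℕ} (t₁ t₂ : L.Term V) : Formula L A V
  | neq {V : Finset ℕ} (t₁ t₂ : L.Term V) : Formula L A V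
  | rel {V : Finset ℕ} {n : ℕ} (R : L.Relations n) (ts : Fin n → L.Term V) : Formula L A V
  | nrel {V : Finset ℕ} {n : ℕ} (R : L.Relations n) (ts : Fin n → L.Term V) : Formula L A V
  | atom {V : Finset ℕ} (a : A V) : Formula L A V
  | natom {V : Finset ℕ} (a : A V) : Formula L A V
  | and {V : Finset ℕ} (φ ψ : Formula L A V) : Formula L A V
  | or {V : Finset ℕ} (φ ψ : Formula L A V) : Formula L A V
  | ex {V : Finset ℕ} (x : ℕ) (φ : Formula L A (insert x V)) : Formula L A V
  | all {V : Finset ℕ} (x : ℕ) (φ : Formula L A (insert x V)) : Formula L A V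

/-- A team with domain `V` on `M`: a set of assignments `V → M`. -/
abbrev Team (V : Finset ℕ) (M : Type w) : Type w := Set (V → M)

section Semantics

variable {M : Type w}

/-- The assignment `s(a/x)`, with domain `V ∪ {x}`: it sends `x` to `a` and agrees with `s` on all
other variables (the old value of `x`, if there is one, is overwritten). -/
def update {V : Finset ℕ} (s : V → M) (x : ℕ) (a : M) : ↥(insert x V) → M :=
  fun y => if h : (y : ℕ) = x then a else s ⟨y, Finset.mem_of_mem_insert_of_ne y.2 h⟩

/-- The team `X(F/x) = {s(F(s)/x) : s ∈ X}` for a function `F : X → M`. -/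
def Team.supplement {V : Finset ℕ} (X : Team V M) (x : ℕ) (F : X → M) : Team (insert x V) M :=
  {s' | ∃ s : X, s' = update s.1 x (F s)}

/-- The team `X(M/x) = {s(a/x) : s ∈ X, a ∈ M}`. -/
def Team.duplicate {V : Finset ℕ} (X : Team V M) (x : ℕ) : Team (insert x V) M :=
  {s' | ∃ s ∈ X, ∃ a : M, s' = update s x a}

/-- Team semantics, given the semantics `sem` of the extra atoms.  Negated extra atoms are
satisfied by the empty team alone. -/
def Formula.Sat {L : FirstOrder.Language.{u, v}} {A : Type → Type} [L.Structure M]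
    (sem : ∀ {V : Finset ℕ}, A V → Team V M → Prop) :
    ∀ {V : Finset ℕ}, Formula L A V → Team V M → Prop
  | _, .eq t₁ t₂, X => ∀ s ∈ X, t₁.realize s = t₂.realize s
  | _, .neq t₁ t₂, X => ∀ s ∈ X, t₁.realize s ≠ t₂.realize s
  | _, .rel R ts, X => ∀ s ∈ X, FirstOrder.Language.Structure.RelMap R (fun i => (ts i).realize s)
  | _, .nrel R ts, X => ∀ s ∈ X, ¬ FirstOrder.Language.Structure.RelMap R (fun i => (ts i).realize s)
  | _, .atom a, X => sem a X
  | _, .natom _, X => X = ∅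
  | _, .and φ ψ, X => φ.Sat sem X ∧ ψ.Sat sem X
  | _, .or φ ψ, X => ∃ Y Z, X = Y ∪ Z ∧ φ.Sat sem Y ∧ ψ.Sat sem Z
  | _, .ex x φ, X => ∃ F : X → M, φ.Sat sem (X.supplement x F)
  | _, .all x φ, X => φ.Sat sem (X.duplicate x)

/-- The assignment `∅`, with empty domain. -/
def emptyAssignment (M : Type w) : ↥(∅ : Finset ℕ) → M :=
  fun y => absurd y.2 (Finset.notMem_empty _)

end Semantics

/-- The dependence atom `=(ys, xs)` for finite sequences `ys`, `xs` of variables. -/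
structure DepAtom (α : Type) : Type where
  ys : List α
  xs : List α

/-- `X ⊨ =(ys, xs)`. -/
def DepAtom.Sat {M : Type w} {V : Finset ℕ} (a : DepAtom V) (X : Team V M) : Prop :=
  ∀ s ∈ X, ∀ s' ∈ X, a.ys.map s = a.ys.map s' → a.xs.map s = a.xs.map s'

/-- The independence atom `ys ⊥_{xs} zs` for finite sequences `ys`, `xs`, `zs` of variables. -/
structure IndepAtom (α : Type) : Type where
  ys : List α
  xs : List α
  zs : List α

/-- `X ⊨ ys ⊥_{xs} zs`. -/
def IndepAtom.Sat {M : Type w} {V : Finset ℕ} (a : IndepAtom V) (X : Team V M) : Prop :=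
  ∀ s ∈ X, ∀ s' ∈ X, a.xs.map s = a.xs.map s' →
    ∃ s'' ∈ X, a.xs.map s'' = a.xs.map s ∧ a.ys.map s'' = a.ys.map s ∧ a.zs.map s'' = a.zs.map s'

/-- Sentences of dependence logic: formulas without free variables. -/
abbrev DepSentence (L : FirstOrder.Language.{u, v}) : Type (max u v) := Formula L DepAtom ∅

/-- Sentences of independence logic: formulas without free variables. -/
abbrev IndepSentence (L : FirstOrder.Language.{u, v}) : Type (max u v) := Formula L IndepAtom ∅

/-- Truth of a sentence of dependence logic: `M ⊨ φ` iff `M ⊨_{{∅}} φ`. -/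
def DepSentence.Models {L : FirstOrder.Language.{u, v}} (M : Type w) [L.Structure M]
    (φ : DepSentence L) : Prop :=
  Formula.Sat DepAtom.Sat φ {emptyAssignment M}

/-- Truth of a sentence of independence logic: `M ⊨ φ` iff `M ⊨_{{∅}} φ`. -/
def IndepSentence.Models {L : FirstOrder.Language.{u, v}} (M : Type w) [L.Structure M]
    (φ : IndepSentence L) : Prop :=
  Formula.Sat IndepAtom.Sat φ {emptyAssignment M}

end TeamLogic

/-!
A dependence atom `=(ys, xs)` says the same as the independence atom `xs ⊥_{ys} xs`, so dependence
logic is a fragment of independence logic (`DepSentence.exists_indepSentence`).  The converse goes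
through existential second-order logic.

A sentence in Skolem form says that there are functions `G` making a quantifier-free matrix true
for all values of its first-order variables.  Dependence logic expresses it by quantifying the
first-order variables universally, then existentially one variable for the value of each
application `f(x₁, …, xₖ)` in the matrix, with dependence atoms making that value a function of
`x₁, …, xₖ`.  Two applications of the same `f` must yield values of one function.  Comparing them
with each other is not enough, as they may share variables; instead each is compared with an
application of `f` to fresh variables (`exists_depSentence_of_nat`).

Conversely, `φ` is satisfied by the team `X` iff there are teams for all subformulas of `φ`, with
`X` for `φ` itself, that fit together as the clauses of team semantics require.  On a domain with at
least two elements, a team is coded by two functions that agree exactly on its members, and each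
clause becomes a universal condition once its witnesses are given by Skolem functions
(`Formula.sat_iff_exists_matrix`).  The strict semantics of `∃` is respected: the values of the
quantified variable are given by a single choice function.

Functions on a domain with one element code nothing, so this case is separated off by a disjunction.
There, all independence atoms are true and can be replaced by a trivial dependence atom
(`IndepSentence.exists_depSentence`).
-/

namespace TeamLogic

/-! ### Team formulas: atoms, conjunctions, the empty team -/

section General

variable {L : FirstOrder.Language.{u, v}} {A B : Type → Type}

/-- Replace every extra atom `a` by `f a`, also under negation. -/
def Formula.mapAtom (f : ∀ {V : Finset ℕ}, A V → B V) :
    ∀ {V : Finset ℕ}, Formula L A V → Formula L B V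
  | _, .eq t₁ t₂ => .eq t₁ t₂
  | _, .neq t₁ t₂ => .neq t₁ t₂
  | _, .rel R ts => .rel R ts
  | _, .nrel R ts => .nrel R ts
  | _, .atom a => .atom (f a)
  | _, .natom a => .natom (f a)
  | _, .and φ ψ => .and (φ.mapAtom f) (ψ.mapAtom f)
  | _, .or φ ψ => .or (φ.mapAtom f) (ψ.mapAtom f)
  | _, .ex x φ => .ex x (φ.mapAtom f)
  | _, .all x φ => .all x (φ.mapAtom f)

theorem Formula.sat_mapAtom {M : Type w} [L.Structure M]
    {semA : ∀ {V : Finset ℕ}, A V → Team V M → Prop}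
    {semB : ∀ {V : Finset ℕ}, B V → Team V M → Prop}
    (f : ∀ {V : Finset ℕ}, A V → B V)
    (hf : ∀ {V : Finset ℕ} (a : A V) (X : Team V M), semB (f a) X ↔ semA a X)
    {V : Finset ℕ} (φ : Formula L A V) (X : Team V M) :
    (φ.mapAtom f).Sat semB X ↔ φ.Sat semA X := by
  induction φ with
  | eq | neq | rel | nrel | natom => rfl
  | atom a => exact hf a X
  | and φ ψ ih₁ ih₂ => simp only [Formula.mapAtom, Formula.Sat, ih₁, ih₂]
  | or φ ψ ih₁ ih₂ => simp only [Formula.mapAtom, Formula.Sat, ih₁, ih₂]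
  | ex x φ ih => simp only [Formula.mapAtom, Formula.Sat, ih]
  | all x φ ih => simp only [Formula.mapAtom, Formula.Sat, ih]

theorem Formula.sat_foldr_and {M : Type w} [L.Structure M]
    {sem : ∀ {V : Finset ℕ}, A V → Team V M → Prop} {V : Finset ℕ}
    (l : List (Formula L A V)) (φ : Formula L A V) (X : Team V M) :
    (l.foldr .and φ).Sat sem X ↔ (∀ χ ∈ l, χ.Sat sem X) ∧ φ.Sat sem X := by
  induction l with
  | nil => simp
  | cons χ l ih => simp only [List.foldr_cons, Formula.Sat, ih, List.forall_mem_cons, and_assoc]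

/-- The empty team satisfies every formula of dependence logic. -/
theorem Formula.sat_empty {M : Type w} [L.Structure M] [Nonempty M] {V : Finset ℕ}
    (φ : Formula L DepAtom V) : φ.Sat (M := M) DepAtom.Sat ∅ := by
  induction φ with
  | eq | neq | rel | nrel => simp [Formula.Sat]
  | atom a => simp [Formula.Sat, DepAtom.Sat]
  | natom a => rfl
  | and φ ψ ih₁ ih₂ => exact ⟨ih₁, ih₂⟩
  | or φ ψ ih₁ ih₂ => exact ⟨∅, ∅, by simp, ih₁, ih₂⟩
  | ex x φ ih =>
    refine ⟨fun _ => Classical.arbitrary M, ?_⟩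
    simpa [Team.supplement] using ih
  | all x φ ih => simpa [Formula.Sat, Team.duplicate] using ih

end General

/-! ### Quantifier-free formulas -/

/-- Quantifier-free first-order formulas with variables from `α`. -/
inductive QFree (L : FirstOrder.Language.{u, v}) (α : Type) : Type (max u v)
  | eq (t₁ t₂ : L.Term α) : QFree L α
  | rel {n : ℕ} (R : L.Relations n) (ts : Fin n → L.Term α) : QFree L α
  | not (φ : QFree L α) : QFree L α
  | and (φ ψ : QFree L α) : QFree L α
  | imp (φ ψ : QFree L α) : QFree L α

namespace QFree

variable {L : FirstOrder.Language.{u, v}} {α β : Type} {M : Type w}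

/-- Truth of a quantifier-free formula under a valuation of its variables. -/
def Sat [L.Structure M] (s : α → M) : QFree L α → Prop
  | eq t₁ t₂ => t₁.realize s = t₂.realize s
  | rel R ts => FirstOrder.Language.Structure.RelMap R (fun i => (ts i).realize s)
  | not φ => ¬ φ.Sat s
  | and φ ψ => φ.Sat s ∧ ψ.Sat s
  | imp φ ψ => φ.Sat s → ψ.Sat s

/-- Rename the variables of a quantifier-free formula. -/
def relabel (f : α → β) : QFree L α → QFree L β
  | eq t₁ t₂ => eq (t₁.relabel f) (t₂.relabel f)
  | rel R ts => rel R (fun i => (ts i).relabel f)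
  | not φ => not (φ.relabel f)
  | and φ ψ => and (φ.relabel f) (ψ.relabel f)
  | imp φ ψ => imp (φ.relabel f) (ψ.relabel f)

@[simp] theorem sat_relabel [L.Structure M] (f : α → β) (θ : QFree L α) (s : β → M) :
    (θ.relabel f).Sat s ↔ θ.Sat (s ∘ f) := by
  induction θ <;> simp_all [relabel, Sat]

/-- Equality of two variables. -/
def veq (a b : α) : QFree L α := eq (.var a) (.var b)

@[simp] theorem sat_veq [L.Structure M] (a b : α) (s : α → M) :
    (veq (L := L) a b).Sat s ↔ s a = s b := Iff.rfl

@[simp] theorem sat_and [L.Structure M] (φ ψ : QFree L α) (s : α → M) :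
    (and φ ψ).Sat s ↔ φ.Sat s ∧ ψ.Sat s := Iff.rfl

@[simp] theorem sat_imp [L.Structure M] (φ ψ : QFree L α) (s : α → M) :
    (imp φ ψ).Sat s ↔ (φ.Sat s → ψ.Sat s) := Iff.rfl

@[simp] theorem sat_not [L.Structure M] (φ : QFree L α) (s : α → M) :
    (not φ).Sat s ↔ ¬ φ.Sat s := Iff.rfl

@[simp] theorem sat_foldr_imp [L.Structure M] (l : List (QFree L α)) (φ : QFree L α) (s : α → M) :
    (l.foldr imp φ).Sat s ↔ ((∀ χ ∈ l, χ.Sat s) → φ.Sat s) := by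
  induction l with
  | nil => simp
  | cons χ l ih => simp [ih]

@[simp] theorem sat_foldr_and [L.Structure M] (l : List (QFree L α)) (φ : QFree L α) (s : α → M) :
    (l.foldr and φ).Sat s ↔ (∀ χ ∈ l, χ.Sat s) ∧ φ.Sat s := by
  induction l with
  | nil => simp
  | cons χ l ih => simp [ih, and_assoc]

/-- Truth depends on the values of finitely many variables only. -/
theorem exists_finset_sat_congr (θ : QFree L α) :
    ∃ S : Finset α, ∀ (M : Type w) [L.Structure M] (s s' : α → M),
      (∀ a ∈ S, s a = s' a) → (θ.Sat s ↔ θ.Sat s') := by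
  classical
  have term (t : L.Term α) (M : Type w) [L.Structure M] (s s' : α → M)
      (h : ∀ a ∈ t.varFinset, s a = s' a) : t.realize s = t.realize s' := by
    induction t with
    | var a => exact h a (by simp [FirstOrder.Language.Term.varFinset])
    | func f ts ih =>
      simp only [FirstOrder.Language.Term.realize]
      congr 1
      funext i
      refine ih i fun a ha => h a ?_
      simp only [FirstOrder.Language.Term.varFinset, Finset.mem_biUnion, Finset.mem_univ, true_and]
      exact ⟨i, ha⟩
  induction θ with
  | eq t₁ t₂ =>
    refine ⟨t₁.varFinset ∪ t₂.varFinset, fun M _ s s' h => ?_⟩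
    simp only [Sat]
    rw [term t₁ M s s' fun a ha => h a (Finset.mem_union_left _ ha),
      term t₂ M s s' fun a ha => h a (Finset.mem_union_right _ ha)]
  | rel R ts =>
    refine ⟨Finset.univ.biUnion fun i => (ts i).varFinset, fun M _ s s' h => ?_⟩
    simp only [Sat]
    rw [funext fun i => term (ts i) M s s' fun a ha =>
      h a (Finset.mem_biUnion.2 ⟨i, Finset.mem_univ _, ha⟩)]
  | not φ ih =>
    obtain ⟨S, hS⟩ := ih
    exact ⟨S, fun M _ s s' h => not_congr (hS M s s' h)⟩
  | and φ ψ ih₁ ih₂ =>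
    obtain ⟨S, hS⟩ := ih₁
    obtain ⟨T, hT⟩ := ih₂
    exact ⟨S ∪ T, fun M _ s s' h =>
      and_congr (hS M s s' fun a ha => h a (Finset.mem_union_left _ ha))
        (hT M s s' fun a ha => h a (Finset.mem_union_right _ ha))⟩
  | imp φ ψ ih₁ ih₂ =>
    obtain ⟨S, hS⟩ := ih₁
    obtain ⟨T, hT⟩ := ih₂
    exact ⟨S ∪ T, fun M _ s s' h =>
      imp_congr (hS M s s' fun a ha => h a (Finset.mem_union_left _ ha))
        (hT M s s' fun a ha => h a (Finset.mem_union_right _ ha))⟩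

/-- The negation normal form of `θ` (for `true`) or of its negation (for `false`), as a formula of
team semantics. -/
def toFormula {A : Type → Type} {V : Finset ℕ} : Bool → QFree L V → Formula L A V
  | true, eq t₁ t₂ => .eq t₁ t₂
  | false, eq t₁ t₂ => .neq t₁ t₂
  | true, rel R ts => .rel R ts
  | false, rel R ts => .nrel R ts
  | b, not φ => φ.toFormula !b
  | true, and φ ψ => .and (φ.toFormula true) (ψ.toFormula true)
  | false, and φ ψ => .or (φ.toFormula false) (ψ.toFormula false)
  | true, imp φ ψ => .or (φ.toFormula false) (ψ.toFormula true)
  | false, imp φ ψ => .and (φ.toFormula true) (ψ.toFormula false)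

/-- First-order formulas are flat: a team satisfies one iff each of its members does. -/
theorem sat_toFormula {A : Type → Type} {V : Finset ℕ} [L.Structure M]
    {sem : ∀ {V : Finset ℕ}, A V → Team V M → Prop} (θ : QFree L V) (b : Bool) (X : Team V M) :
    (θ.toFormula b).Sat sem X ↔ ∀ s ∈ X, (θ.Sat s ↔ b = true) := by
  have split (p q : (V → M) → Prop) (X : Team V M) :
      (∃ Y Z : Team V M, X = Y ∪ Z ∧ (∀ s ∈ Y, p s) ∧ ∀ s ∈ Z, q s) ↔ ∀ s ∈ X, p s ∨ q s := by
    constructor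
    · rintro ⟨Y, Z, rfl, hY, hZ⟩ s (hs | hs)
      exacts [.inl (hY s hs), .inr (hZ s hs)]
    · intro h
      refine ⟨{s ∈ X | p s}, {s ∈ X | q s}, ?_, fun s hs => hs.2, fun s hs => hs.2⟩
      ext s
      have := h s
      simp only [Set.mem_union, Set.mem_ofPred_eq]
      tauto
  induction θ generalizing b X with
  | eq | rel => cases b <;> simp [toFormula, Formula.Sat, Sat]
  | not φ ih =>
    cases b <;> simp [toFormula, ih]
  | and φ ψ ih₁ ih₂ =>
    cases b
    · simp only [toFormula, Formula.Sat, ih₁, ih₂, split, sat_and]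
      exact forall₂_congr fun s _ => by simp; tauto
    · simp only [toFormula, Formula.Sat, ih₁, ih₂, sat_and, ← forall₂_and]
      exact forall₂_congr fun s _ => by simp
  | imp φ ψ ih₁ ih₂ =>
    cases b
    · simp only [toFormula, Formula.Sat, ih₁, ih₂, sat_imp, ← forall₂_and]
      exact forall₂_congr fun s _ => by simp
    · simp only [toFormula, Formula.Sat, ih₁, ih₂, split, sat_imp]
      exact forall₂_congr fun s _ => by simp; tauto

end QFree

/-! ### Quantifier prefixes -/

/-- The domain `{x₀, …, xₙ₋₁}`, defined by recursion so that quantifying `xₙ` in a formula over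
`dom (n + 1)` gives a formula over `dom n` by definitional unfolding. -/
def dom : ℕ → Finset ℕ
  | 0 => ∅
  | n + 1 => insert n (dom n)

theorem mem_dom {k n : ℕ} : k ∈ dom n ↔ k < n := by
  induction n with
  | zero => simp [dom]
  | succ n ih => simp only [dom, Finset.mem_insert, ih]; omega

/-- The restriction to `V` of an assignment defined on all variables. -/
def res {M : Type w} (V : Finset ℕ) (s : ℕ → M) : V → M := fun v => s v

theorem exists_res_eq {M : Type w} [Nonempty M] {V : Finset ℕ} (s : V → M) :
    ∃ s' : ℕ → M, res V s' = s := by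
  classical
  exact ⟨fun k => if h : k ∈ V then s ⟨k, h⟩ else Classical.arbitrary M,
    funext fun v => by simp [res]⟩

theorem res_eq_res {M : Type w} {V : Finset ℕ} {s s' : ℕ → M} :
    res V s = res V s' ↔ ∀ v ∈ V, s v = s' v := by
  simp [funext_iff, res]

section Prefix

variable {L : FirstOrder.Language.{u, v}} {A : Type → Type} {M : Type w} [L.Structure M]
  {sem : ∀ {V : Finset ℕ}, A V → Team V M → Prop}

/-- `∀ x₀ … ∀ xₙ₋₁ φ`. -/
def Formula.closeAll : (n : ℕ) → Formula L A (dom n) → Formula L A ∅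
  | 0, φ => φ
  | n + 1, φ => closeAll n (.all n φ)

/-- `∃ xₙ … ∃ xₙ₊ₘ₋₁ φ`. -/
def Formula.closeEx (n : ℕ) : (m : ℕ) → Formula L A (dom (n + m)) → Formula L A (dom n)
  | 0, φ => φ
  | m + 1, φ => closeEx n m (.ex (n + m) φ)

theorem duplicate_univ {V : Finset ℕ} [Nonempty M] (x : ℕ) :
    Team.duplicate (Set.univ : Team V M) x = Set.univ := by
  refine Set.eq_univ_of_forall fun s => ?_
  obtain ⟨s, rfl⟩ := exists_res_eq s
  refine ⟨res V s, trivial, s x, funext fun y => ?_⟩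
  by_cases h : (y : ℕ) = x <;> simp [update, res, h]

theorem Formula.sat_closeAll [Nonempty M] (n : ℕ) (φ : Formula L A (dom n)) :
    (φ.closeAll n).Sat sem {emptyAssignment M} ↔ φ.Sat sem Set.univ := by
  induction n with
  | zero =>
    have : (Set.univ : Team ∅ M) = {emptyAssignment M} :=
      Set.eq_singleton_iff_unique_mem.2 ⟨trivial, fun s _ => funext fun y =>
        absurd y.2 (Finset.notMem_empty _)⟩
    rw [Formula.closeAll]
    exact this ▸ Iff.rfl
  | succ n ih =>
    refine (ih (.all n φ)).trans ?_
    change φ.Sat sem (Team.duplicate Set.univ n) ↔ _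
    rw [duplicate_univ]
    rfl

/-- The team in which the values of `xₙ, …, xₙ₊ₘ₋₁` are given by Skolem functions `Y` in terms of
the values of `x₀, …, xₙ₋₁`, which are arbitrary. -/
def skolemTeam (n m : ℕ) (Y : ℕ → (dom n → M) → M) : Team (dom (n + m)) M :=
  {s | ∃ z : ℕ → M, (∀ j < m, z (n + j) = Y j (res _ z)) ∧ s = res _ z}

theorem mem_skolemTeam_succ {n m : ℕ} {Y : ℕ → (dom n → M) → M} (s : dom (n + (m + 1)) → M) :
    s ∈ skolemTeam n (m + 1) Y ↔
      ∃ z : ℕ → M, (∀ j < m, z (n + j) = Y j (res _ z)) ∧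
        s = update (res (dom (n + m)) z) (n + m) (Y m (res _ z)) := by
  constructor
  · rintro ⟨z, hz, rfl⟩
    refine ⟨z, fun j hj => hz j (by omega), funext fun y => ?_⟩
    by_cases h : (y : ℕ) = n + m
    · simp [update, res, h, ← hz m]
    · simp [update, res, h]
  · rintro ⟨z, hz, rfl⟩
    have hres : res (dom n) (Function.update z (n + m) (Y m (res _ z))) = res (dom n) z :=
      res_eq_res.2 fun v hv => Function.update_of_ne (by have := mem_dom.1 hv; omega) _ _
    refine ⟨Function.update z (n + m) (Y m (res _ z)), fun j hj => ?_, funext fun y => ?_⟩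
    · rw [hres]
      rcases Nat.lt_succ_iff_lt_or_eq.1 hj with h | rfl
      · rw [Function.update_of_ne (by omega), hz j h]
      · simp
    · by_cases h : (y : ℕ) = n + m <;> simp [update, res, h]

theorem Formula.sat_closeEx [Nonempty M] (n m : ℕ) (φ : Formula L A (dom (n + m))) :
    (φ.closeEx n m).Sat sem Set.univ ↔
      ∃ Y : ℕ → (dom n → M) → M, φ.Sat sem (skolemTeam n m Y) := by
  induction m with
  | zero =>
    have : ∀ Y : ℕ → (dom n → M) → M, skolemTeam n 0 Y = Set.univ := fun Y =>
      Set.eq_univ_of_forall fun s => by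
        obtain ⟨z, rfl⟩ := exists_res_eq s
        exact ⟨z, by simp, rfl⟩
    simp only [this]
    exact ⟨fun h => ⟨fun _ _ => Classical.arbitrary M, h⟩, fun ⟨_, h⟩ => h⟩
  | succ m ih =>
    rw [Formula.closeEx, ih]
    constructor
    · rintro ⟨Y, F, h⟩
      -- A member of the team is determined by its values on the universally quantified variables.
      have key : ∀ s : dom n → M, ∃ a, ∀ z (hz : ∀ j < m, z (n + j) = Y j (res _ z)),
          res _ z = s → F ⟨res _ z, z, hz, rfl⟩ = a := by
        intro s
        by_cases hs : ∃ z, (∀ j < m, z (n + j) = Y j (res _ z)) ∧ res _ z = s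
        · obtain ⟨z, hz, hzs⟩ := hs
          refine ⟨F ⟨res _ z, z, hz, rfl⟩, fun z' hz' hz's => ?_⟩
          congr 2
          refine res_eq_res.2 fun v hv => ?_
          by_cases hvn : v < n
          · exact res_eq_res.1 (hz's.trans hzs.symm) v (mem_dom.2 hvn)
          · obtain ⟨j, rfl⟩ := Nat.exists_eq_add_of_le (not_lt.1 hvn)
            have hj : j < m := by have := mem_dom.1 hv; omega
            rw [hz j hj, hz' j hj, hzs, hz's]
        · exact ⟨Classical.arbitrary M, fun z hz hzs => absurd ⟨z, hz, hzs⟩ hs⟩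
      choose G hG using key
      refine ⟨fun j => if j = m then G else Y j, ?_⟩
      suffices hT : skolemTeam n (m + 1) (fun j => if j = m then G else Y j) =
          Team.supplement (skolemTeam n m Y) (n + m) F by rw [hT]; exact h
      ext s
      have hY : ∀ z : ℕ → M,
          (∀ j < m, z (n + j) = (if j = m then G else Y j) (res _ z)) ↔
            ∀ j < m, z (n + j) = Y j (res _ z) := fun z =>
        forall₂_congr fun j hj => by rw [if_neg hj.ne]
      rw [mem_skolemTeam_succ]
      simp only [hY, if_true]
      constructor
      · rintro ⟨z, hz, rfl⟩
        exact ⟨⟨res _ z, z, hz, rfl⟩, by rw [hG _ z hz rfl]⟩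
      · rintro ⟨⟨_, z, hz, rfl⟩, rfl⟩
        exact ⟨z, hz, by rw [hG _ z hz rfl]⟩
    · rintro ⟨Y, h⟩
      have hsub : ∀ v : dom n, (v : ℕ) ∈ dom (n + m) := fun v =>
        mem_dom.2 (by have := mem_dom.1 v.2; omega)
      refine ⟨Y, fun s => Y m fun v => s.1 ⟨v, hsub v⟩, ?_⟩
      suffices hT : skolemTeam n (m + 1) Y = Team.supplement (skolemTeam n m Y) (n + m)
          (fun s => Y m fun v => s.1 ⟨v, hsub v⟩) by rw [hT] at h; exact h
      ext s
      rw [mem_skolemTeam_succ]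
      constructor
      · rintro ⟨z, hz, rfl⟩
        exact ⟨⟨_, z, hz, rfl⟩, rfl⟩
      · rintro ⟨⟨_, z, hz, rfl⟩, rfl⟩
        exact ⟨z, hz, rfl⟩

end Prefix

/-! ### Existential second-order sentences in Skolem form -/

/-- The variables of the matrix of an existential second-order sentence: a first-order variable
`x` from `κ`, or an application `f(x₁, …, xₖ)` of a function variable `f` from `ι` to first-order
variables.  Function variables have no fixed arity. -/
abbrev Leaf (ι κ : Type) : Type := κ ⊕ ι × List κ

/-- The values of first-order variables and applications, when first-order variables have the
values `x` and function variables the values `G`. -/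
def leafVal {ι κ : Type} {M : Type w} (G : ι → List M → M) (x : κ → M) : Leaf ι κ → M :=
  Sum.elim x fun a => G a.1 (a.2.map x)

@[simp] theorem leafVal_inl {ι κ : Type} {M : Type w} (G : ι → List M → M) (x : κ → M) (k : κ) :
    leafVal G x (.inl k) = x k := rfl

@[simp] theorem leafVal_inr {ι κ : Type} {M : Type w} (G : ι → List M → M) (x : κ → M)
    (a : ι × List κ) : leafVal G x (.inr a) = G a.1 (a.2.map x) := rfl

/-- Rename function variables by `f` and first-order variables by `g`. -/
def leafMap {ι ι' κ κ' : Type} (f : ι → ι') (g : κ → κ') : Leaf ι κ → Leaf ι' κ' :=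
  Sum.map g (Prod.map f (List.map g))

theorem leafVal_comp_leafMap {ι ι' κ κ' : Type} {M : Type w} (f : ι → ι') (g : κ → κ')
    (G : ι' → List M → M) (x : κ' → M) :
    leafVal G x ∘ leafMap f g = leafVal (G ∘ f) (x ∘ g) := by
  funext a
  rcases a with a | a <;> simp [leafVal, leafMap]

/-- Two applications with equal arguments have equal values. -/
def consistent {L : FirstOrder.Language.{u, v}} {ι κ : Type} (a b : ι × List κ) :
    QFree L (Leaf ι κ) :=
  (List.zipWith (fun x y => QFree.veq (.inl x) (.inl y)) a.2 b.2).foldr .imp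
    (.veq (.inr a) (.inr b))

theorem sat_consistent {L : FirstOrder.Language.{u, v}} {ι κ : Type} {M : Type w} [L.Structure M]
    {a b : ι × List κ} (hab : a.2.length = b.2.length) (val : Leaf ι κ → M) :
    (consistent (L := L) a b).Sat val ↔
      (a.2.map (val ∘ .inl) = b.2.map (val ∘ .inl) → val (.inr a) = val (.inr b)) := by
  rw [consistent, QFree.sat_foldr_imp, QFree.sat_veq]
  refine imp_congr_left ?_
  obtain ⟨i, l⟩ := a
  obtain ⟨j, l'⟩ := b
  simp only at hab ⊢
  clear i j
  induction l generalizing l' with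
  | nil => cases l' <;> simp_all
  | cons x l ih =>
    cases l' with
    | nil => simp at hab
    | cons y l' => simp [ih l' (by simpa using hab)]

section DepSentences

variable {L : FirstOrder.Language.{u, v}} {ι : Type}

theorem map_congr_of_lt {M : Type w} {n : ℕ} {l : List ℕ} (hl : ∀ k ∈ l, k < n) {x x' : ℕ → M}
    (h : ∀ k < n, x k = x' k) : l.map x = l.map x' :=
  List.map_congr_left fun k hk => h k (hl k hk)

/-- Dependence logic expresses that each application `a` in a finite list has a value `Y a`, a
function of its arguments, making `θ` true for all values of the first-order variables.  Nothing
relates the values of different applications of one function variable. -/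
theorem exists_depSentence_of_applications {n : ℕ} (hn : 0 < n) (apps : List (ι × List ℕ))
    (happs : ∀ a ∈ apps, ∀ k ∈ a.2, k < n) (θ : QFree L (Leaf ι ℕ))
    (hθ : ∀ (M : Type w) [L.Structure M] (val val' : Leaf ι ℕ → M),
      (∀ k < n, val (.inl k) = val' (.inl k)) → (∀ a ∈ apps, val (.inr a) = val' (.inr a)) →
        (θ.Sat val ↔ θ.Sat val')) :
    ∃ ψ : DepSentence L, ∀ (M : Type w) [L.Structure M] [Nonempty M],
      DepSentence.Models M ψ ↔ ∃ Y : ι × List ℕ → (ℕ → M) → M,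
        (∀ a ∈ apps, ∀ x x', a.2.map x = a.2.map x' → Y a x = Y a x') ∧
          ∀ x, θ.Sat (Sum.elim x fun a => Y a x) := by
  classical
  let m := apps.length
  -- The variable `xₙ₊ⱼ` stands for the `j`-th application.  Leaves without a variable are sent to
  -- `x₀`; the truth of `θ` does not depend on them.
  let num : Leaf ι ℕ → ℕ := Sum.elim id fun a => n + apps.idxOf a
  let lf : Leaf ι ℕ → dom (n + m) := fun l =>
    if h : num l < n + m then ⟨num l, mem_dom.2 h⟩ else ⟨0, mem_dom.2 (by omega)⟩
  have lf_inl {M : Type w} (z : ℕ → M) {k : ℕ} (hk : k < n) : res _ z (lf (.inl k)) = z k := by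
    have : num (.inl k) < n + m := show k < n + m by omega
    simp only [lf, dif_pos this]
    rfl
  have lf_inr {M : Type w} (z : ℕ → M) {a : ι × List ℕ} (ha : a ∈ apps) :
      res _ z (lf (.inr a)) = z (n + apps.idxOf a) := by
    have : num (.inr a) < n + m := Nat.add_lt_add_left (List.idxOf_lt_length_of_mem ha) n
    simp only [lf, dif_pos this]
    rfl
  have lf_args {M : Type w} (z : ℕ → M) {a : ι × List ℕ} (ha : a ∈ apps) :
      (a.2.map (lf ∘ .inl)).map (res _ z) = a.2.map z := by
    rw [List.map_map]
    exact List.map_congr_left fun k hk => lf_inl z (happs a ha k hk)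
  let atoms : List (Formula L DepAtom (dom (n + m))) :=
    apps.map fun a => .atom ⟨a.2.map (lf ∘ .inl), [lf (.inr a)]⟩
  let χ : Formula L DepAtom (dom (n + m)) := atoms.foldr .and ((θ.relabel lf).toFormula true)
  refine ⟨(χ.closeEx n m).closeAll n, fun M _ _ => ?_⟩
  rw [DepSentence.Models, Formula.sat_closeAll, Formula.sat_closeEx]
  simp only [χ, atoms, Formula.sat_foldr_and, QFree.sat_toFormula, List.forall_mem_map,
    Formula.Sat, DepAtom.Sat, QFree.sat_relabel, iff_true]
  constructor
  · rintro ⟨Y, hdep, hsat⟩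
    let z (x : ℕ → M) : ℕ → M := fun k => if k < n then x k else Y (k - n) (res _ x)
    have hz_lt (x : ℕ → M) (k : ℕ) (hk : k < n) : z x k = x k := if_pos hk
    have hz_res (x : ℕ → M) : res (dom n) (z x) = res _ x :=
      res_eq_res.2 fun v hv => hz_lt x v (mem_dom.1 hv)
    have hz_add (x : ℕ → M) (j : ℕ) : z x (n + j) = Y j (res _ x) := by simp [z]
    have hz_mem (x : ℕ → M) : res _ (z x) ∈ skolemTeam n m Y :=
      ⟨z x, fun j _ => by rw [hz_add, hz_res], rfl⟩
    refine ⟨fun a x => Y (apps.idxOf a) (res _ x), fun a ha x x' h => ?_, fun x => ?_⟩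
    · have := hdep a ha _ (hz_mem x) _ (hz_mem x') (by
        rw [lf_args _ ha, lf_args _ ha, map_congr_of_lt (happs a ha) (hz_lt x), h,
          map_congr_of_lt (happs a ha) (hz_lt x')])
      simpa [lf_inr _ ha, hz_add] using this
    · refine (hθ M _ _ (fun k hk => ?_) fun a ha => ?_).1 (hsat _ (hz_mem x))
      · simp only [Function.comp_apply, lf_inl _ hk, hz_lt x k hk, Sum.elim_inl]
      · simp only [Function.comp_apply, lf_inr _ ha, hz_add, Sum.elim_inr]
  · rintro ⟨Y, hY, hsat⟩
    choose e he using fun s : dom n → M => exists_res_eq s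
    let Y' : ℕ → (dom n → M) → M := fun j s =>
      if h : j < m then Y apps[j] (e s) else Classical.arbitrary M
    have hval {z : ℕ → M} (hz : ∀ j < m, z (n + j) = Y' j (res _ z)) {a : ι × List ℕ}
        (ha : a ∈ apps) : z (n + apps.idxOf a) = Y a z := by
      have hi : apps.idxOf a < m := List.idxOf_lt_length_of_mem ha
      rw [hz _ hi]
      simp only [Y', dif_pos hi, List.getElem_idxOf]
      refine hY a ha _ _ (map_congr_of_lt (happs a ha) fun k hk => ?_)
      exact res_eq_res.1 (he (res _ z)) k (mem_dom.2 hk)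
    refine ⟨Y', ?_, ?_⟩
    · rintro a ha _ ⟨z, hz, rfl⟩ _ ⟨z', hz', rfl⟩ h
      rw [lf_args _ ha, lf_args _ ha] at h
      simpa [lf_inr _ ha, hval hz ha, hval hz' ha] using hY a ha _ _ h
    · rintro _ ⟨z, hz, rfl⟩
      refine (hθ M _ _ (fun k hk => ?_) fun a ha => ?_).2 (hsat z)
      · simp only [Function.comp_apply, lf_inl _ hk, Sum.elim_inl]
      · simp only [Function.comp_apply, lf_inr _ ha, hval hz ha, Sum.elim_inr]

/-- Dependence logic expresses every existential second-order sentence in Skolem form.  Besides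
the applications in `θ`, the sentence mentions for each of them the same function variable applied
to fresh first-order variables `x_N, x_{N+1}, …`; as those can take any values, it suffices to
require that every application agrees with its fresh counterpart when the arguments agree. -/
theorem exists_depSentence_of_nat (θ : QFree L (Leaf ι ℕ)) :
    ∃ ψ : DepSentence L, ∀ (M : Type w) [L.Structure M] [Nonempty M],
      DepSentence.Models M ψ ↔ ∃ G : ι → List M → M, ∀ x, θ.Sat (leafVal G x) := by
  classical
  obtain ⟨S, hS⟩ := QFree.exists_finset_sat_congr.{u, v, w} θ
  let apps := S.toRight.toList
  have mem_apps {a} : a ∈ apps ↔ .inr a ∈ S := by simp [apps]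
  let N := (S.toLeft ∪ S.toRight.biUnion fun a => a.2.toFinset).sup id + 1
  have hN_inl {k} (hk : .inl k ∈ S) : k < N := Nat.lt_succ_of_le <|
    Finset.le_sup (f := id) (Finset.mem_union_left _ (by simpa using hk))
  have hN_args {a} (ha : a ∈ apps) {k} (hk : k ∈ a.2) : k < N := Nat.lt_succ_of_le <|
    Finset.le_sup (f := id) (Finset.mem_union_right _ (Finset.mem_biUnion.2
      ⟨a, by simpa [apps] using ha, by simpa using hk⟩))
  let K := S.toRight.sup fun a => a.2.length
  have hK {a} (ha : a ∈ apps) : a.2.length ≤ K :=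
    Finset.le_sup (f := fun a : ι × List ℕ => a.2.length) (by simpa [apps] using ha)
  let fresh : ι × List ℕ → ι × List ℕ := fun a => (a.1, List.range' N a.2.length)
  let cons : List (QFree L (Leaf ι ℕ)) := apps.map fun a => consistent a (fresh a)
  have hcons {M : Type w} [L.Structure M] (val : Leaf ι ℕ → M) :
      (∀ χ ∈ cons, χ.Sat val) ↔ ∀ a ∈ apps,
        a.2.map (val ∘ .inl) = (fresh a).2.map (val ∘ .inl) →
          val (.inr a) = val (.inr (fresh a)) := by
    simp only [cons, List.forall_mem_map]
    exact forall₂_congr fun a _ => sat_consistent (by simp [fresh]) val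
  have hargs : ∀ a ∈ apps ++ apps.map fresh, ∀ k ∈ a.2, k < N + K := by
    intro a ha k hk
    rcases List.mem_append.1 ha with ha | ha
    · exact (hN_args ha hk).trans_le (Nat.le_add_right _ _)
    · obtain ⟨b, hb, rfl⟩ := List.mem_map.1 ha
      have := List.mem_range'_1.1 hk
      have := hK hb
      omega
  have mem_fresh {a} (ha : a ∈ apps) : fresh a ∈ apps ++ apps.map fresh :=
    List.mem_append_right _ (List.mem_map_of_mem ha)
  obtain ⟨ψ, hψ⟩ := exists_depSentence_of_applications.{u, v, w} (n := N + K)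
    (by omega) (apps ++ apps.map fresh) hargs (cons.foldr .and θ) (by
      intro M _ val val' h₁ h₂
      rw [QFree.sat_foldr_and, QFree.sat_foldr_and, hcons, hcons]
      refine and_congr (forall₂_congr fun a ha => ?_) (hS M val val' ?_)
      · rw [h₂ _ (List.mem_append_left _ ha), h₂ _ (mem_fresh ha),
          map_congr_of_lt (hargs _ (List.mem_append_left _ ha)) (x := val ∘ .inl)
            (x' := val' ∘ .inl) h₁,
          map_congr_of_lt (hargs _ (mem_fresh ha)) (x := val ∘ .inl) (x' := val' ∘ .inl) h₁]
      · rintro (k | a) h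
        · exact h₁ k ((hN_inl h).trans_le (Nat.le_add_right _ _))
        · exact h₂ a (List.mem_append_left _ (mem_apps.2 h)))
  refine ⟨ψ, fun M _ _ => ?_⟩
  rw [hψ]
  simp only [QFree.sat_foldr_and, hcons]
  constructor
  · rintro ⟨Y, hdep, hsat⟩
    -- The assignment giving the fresh variables the values in `l`, in order.
    let spread (l : List M) : ℕ → M := fun k => l.getD (k - N) (Classical.arbitrary M)
    have hspread (l : List M) : (List.range' N l.length).map (spread l) = l :=
      List.ext_getElem (by simp) fun i h₁ h₂ => by simp [spread, h₂]
    refine ⟨fun i l => Y (i, List.range' N l.length) (spread l), fun x => ?_⟩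
    refine (hS M _ _ ?_).1 (hsat x).2
    rintro (k | a) h
    · rfl
    · have ha := mem_apps.2 h
      let l := a.2.map x
      have hl : l.length = a.2.length := List.length_map _
      -- The variables of `a` keep their values; the fresh ones list the values of its arguments.
      let x' : ℕ → M := fun k => if k < N then x k else spread l k
      have h₁ : a.2.map x' = l := map_congr_of_lt (fun k hk => hN_args ha hk) fun k hk => if_pos hk
      have h₂ : (fresh a).2.map x' = (fresh a).2.map (spread l) :=
        List.map_congr_left fun k hk => if_neg (by
          have := List.mem_range'_1.1 hk
          omega)
      have h₃ : (fresh a).2.map (spread l) = l := by simpa [fresh, hl] using hspread l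
      calc Y a x = Y a x' := hdep a (List.mem_append_left _ ha) _ _ h₁.symm
        _ = Y (fresh a) x' := (hsat x').1 a ha (h₁.trans (h₂.trans h₃).symm)
        _ = Y (fresh a) (spread l) := hdep _ (mem_fresh ha) _ _ h₂
        _ = leafVal (fun i l => Y (i, List.range' N l.length) (spread l)) x (.inr a) := by
          simp [leafVal, fresh, l]
  · rintro ⟨G, hG⟩
    refine ⟨fun a x => G a.1 (a.2.map x), fun a _ x x' h => congrArg (G a.1) h, fun x => ⟨?_, hG x⟩⟩
    intro a _ h
    exact congrArg (G a.1) h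

/-- The first-order variables may come from any encodable type. -/
theorem exists_depSentence {κ : Type} [Encodable κ] (θ : QFree L (Leaf ι κ)) :
    ∃ ψ : DepSentence L, ∀ (M : Type w) [L.Structure M] [Nonempty M],
      DepSentence.Models M ψ ↔ ∃ G : ι → List M → M, ∀ x, θ.Sat (leafVal G x) := by
  obtain ⟨ψ, hψ⟩ := exists_depSentence_of_nat.{u, v, w}
    (θ.relabel (leafMap id Encodable.encode))
  refine ⟨ψ, fun M _ _ => (hψ M).trans (exists_congr fun G => ?_)⟩
  simp only [QFree.sat_relabel, leafVal_comp_leafMap]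
  refine ⟨fun h x => ?_, fun h x => h _⟩
  have hx : (Function.extend Encodable.encode x fun _ => Classical.arbitrary M) ∘
      Encodable.encode = x := funext fun a => Encodable.encode_injective.extend_apply _ _ a
  simpa only [hx, Function.comp_id] using
    h (Function.extend Encodable.encode x fun _ => Classical.arbitrary M)

end DepSentences

/-! ### Independence logic in existential second-order logic -/

/-- Function variables for the translation of a formula: those of the formula itself, and those of
its (at most two) immediate subformulas. -/
inductive Idx : Type
  | here (k : ℕ)
  | left (i : Idx)
  | right (i : Idx)

/-- An interpretation of the function variables of a formula from its parts. -/
def Idx.combine {M : Type w} (g : ℕ → List M → M) (G₁ G₂ : Idx → List M → M) :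
    Idx → List M → M
  | .here k => g k
  | .left i => G₁ i
  | .right i => G₂ i

theorem Idx.combine_comp_left {M : Type w} (g : ℕ → List M → M) (G₁ G₂ : Idx → List M → M) :
    Idx.combine g G₁ G₂ ∘ .left = G₁ := rfl

/-- An enumeration of `V`. -/
noncomputable def vars (V : Finset ℕ) : List V := V.attach.toList

theorem mem_vars {V : Finset ℕ} (v : V) : v ∈ vars V := by simp [vars]

theorem map_vars_injective {M : Type w} (V : Finset ℕ) :
    Function.Injective fun s : V → M => (vars V).map s := fun _ _ h =>
  funext fun v => List.map_inj_left.1 h v (mem_vars v)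

theorem exists_forall_map_vars {M : Type w} [Nonempty M] {V : Finset ℕ} (h : (V → M) → M) :
    ∃ g : List M → M, ∀ s, g ((vars V).map s) = h s :=
  ⟨_, fun s => (map_vars_injective V).extend_apply h (fun _ => Classical.arbitrary M) s⟩

theorem exists_forall_map_vars_append {M : Type w} [Nonempty M] {V : Finset ℕ}
    (h : (V → M) → (V → M) → M) :
    ∃ g : List M → M, ∀ s s', g ((vars V).map s ++ (vars V).map s') = h s s' := by
  have inj : Function.Injective fun p : (V → M) × (V → M) =>
      (vars V).map p.1 ++ (vars V).map p.2 := fun p q hpq => by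
    obtain ⟨h₁, h₂⟩ := List.append_inj hpq (by simp)
    exact Prod.ext (map_vars_injective V h₁) (map_vars_injective V h₂)
  exact ⟨_, fun s s' =>
    inj.extend_apply (fun p => h p.1 p.2) (fun _ => Classical.arbitrary M) (s, s')⟩

/-- The team coded by two functions: the assignments at which they agree.  Assignments are passed
to them as lists of values. -/
def teamOf {M : Type w} (V : Finset ℕ) (G : Idx → List M → M) : Team V M :=
  {s | G (.here 0) ((vars V).map s) = G (.here 1) ((vars V).map s)}

/-- On a domain with two elements, every team has a code. -/
theorem exists_code {M : Type w} [Nontrivial M] {V : Finset ℕ} (X : Team V M) :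
    ∃ e₀ e₁ : List M → M, ∀ s, e₀ ((vars V).map s) = e₁ ((vars V).map s) ↔ s ∈ X := by
  classical
  obtain ⟨a, b, hab⟩ := exists_pair_ne M
  obtain ⟨g, hg⟩ := exists_forall_map_vars fun s : V → M => if s ∈ X then a else b
  refine ⟨fun _ => a, g, fun s => ?_⟩
  rw [hg]
  by_cases h : s ∈ X <;> simp [h, hab]

theorem team_ext_res {M : Type w} [Nonempty M] {V : Finset ℕ} {X Y : Team V M} :
    X = Y ↔ ∀ t : ℕ → M, res V t ∈ X ↔ res V t ∈ Y := by
  refine ⟨fun h t => h ▸ Iff.rfl, fun h => Set.ext fun s => ?_⟩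
  obtain ⟨t, rfl⟩ := exists_res_eq s
  exact h t

/-- The team of all `s(a/x)` with `s ∈ X` and `Q s a`; supplementation and duplication are
special cases. -/
def Team.extend {M : Type w} {V : Finset ℕ} (X : Team V M) (x : ℕ) (Q : (V → M) → M → Prop) :
    Team (insert x V) M :=
  {s' | ∃ s ∈ X, ∃ a, Q s a ∧ s' = update s x a}

theorem Team.supplement_eq_extend {M : Type w} {V : Finset ℕ} (X : Team V M) (x : ℕ)
    (F : (V → M) → M) : X.supplement x (fun s => F s) = X.extend x fun s a => a = F s := by
  ext s'
  simp [Team.supplement, Team.extend]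

theorem Team.duplicate_eq_extend {M : Type w} {V : Finset ℕ} (X : Team V M) (x : ℕ) :
    X.duplicate x = X.extend x fun _ _ => True := by
  ext s'
  simp [Team.duplicate, Team.extend]

theorem res_insert_eq_update {M : Type w} {V : Finset ℕ} {x : ℕ} {t t' : ℕ → M}
    (h : ∀ v ∈ V, v ≠ x → t v = t' v) : res (insert x V) t' = update (res V t) x (t' x) := by
  funext y
  by_cases hy : (y : ℕ) = x
  · simp [res, update, hy]
  · simp [res, update, hy, h y (Finset.mem_of_mem_insert_of_ne y.2 hy)]

/-- A universal characterization of `Team.extend`, with a Skolem function `H` that recovers the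
overwritten value of `x`. -/
theorem Team.eq_extend_iff {M : Type w} [Nonempty M] {V : Finset ℕ} {X : Team V M} {x : ℕ}
    {Q : (V → M) → M → Prop} {X' : Team (insert x V) M} :
    X' = X.extend x Q ↔ ∃ H : (↥(insert x V) → M) → M, ∀ t t' : ℕ → M,
      (∀ v ∈ V, v ≠ x → t v = t' v) →
        (res V t ∈ X → Q (res V t) (t' x) → res _ t' ∈ X') ∧
          (res _ t' ∈ X' → t x = H (res _ t') → res V t ∈ X ∧ Q (res V t) (t' x)) := by
  classical
  constructor
  · rintro rfl
    have (s' : ↥(insert x V) → M) : ∃ a, s' ∈ X.extend x Q → ∃ s ∈ X, ∃ b, Q s b ∧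
        s' = update s x b ∧ ∀ h : x ∈ V, s ⟨x, h⟩ = a := by
      by_cases hs' : s' ∈ X.extend x Q
      · obtain ⟨s, hs, b, hb, rfl⟩ := hs'
        exact ⟨if h : x ∈ V then s ⟨x, h⟩ else b, fun _ =>
          ⟨s, hs, b, hb, rfl, fun h => by simp [h]⟩⟩
      · exact ⟨Classical.arbitrary M, fun h => absurd h hs'⟩
    choose H hH using this
    refine ⟨H, fun t t' hag => ⟨fun ht hQ => ⟨_, ht, _, hQ, res_insert_eq_update hag⟩, ?_⟩⟩
    intro ht' htx
    obtain ⟨s, hs, b, hb, hsb, hsx⟩ := hH _ ht'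
    have hval (y) : t' y.1 = update s x b y := congrFun hsb y
    have hx : t' x = b := by simpa [update] using hval ⟨x, Finset.mem_insert_self x V⟩
    have : res V t = s := by
      funext v
      by_cases hv : (v : ℕ) = x
      · obtain ⟨v, hv'⟩ := v
        obtain rfl : v = x := hv
        exact htx.trans (hsx hv').symm
      · have := hval ⟨v, Finset.mem_insert_of_mem v.2⟩
        simpa [update, hv, res, ← hag v v.2 hv] using this
    rw [this, hx]
    exact ⟨hs, hb⟩
  · rintro ⟨H, hH⟩
    ext s'
    constructor
    · intro hs'
      obtain ⟨t', rfl⟩ := exists_res_eq s'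
      let t := Function.update t' x (H (res _ t'))
      have hag : ∀ v ∈ V, v ≠ x → t v = t' v := fun v _ hv => Function.update_of_ne hv _ _
      obtain ⟨h₁, h₂⟩ := (hH t t' hag).2 hs' (Function.update_self ..)
      exact ⟨_, h₁, _, h₂, res_insert_eq_update hag⟩
    · rintro ⟨s, hs, a, ha, rfl⟩
      obtain ⟨t, rfl⟩ := exists_res_eq s
      let t' := Function.update t x a
      have hag : ∀ v ∈ V, v ≠ x → t v = t' v := fun v _ hv => (Function.update_of_ne hv _ _).symm
      have htx : t' x = a := Function.update_self ..
      have := (hH t t' hag).1 hs (htx ▸ ha)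
      rwa [res_insert_eq_update hag, htx] at this

section Translation

variable {L : FirstOrder.Language.{u, v}}

/-- The matrix of the translation of a formula.  First-order variables are pairs `(b, v)`: the
value of the variable `v` under the `b`-th of several assignments. -/
abbrev SkolemMatrix (L : FirstOrder.Language.{u, v}) : Type (max u v) := QFree L (Leaf Idx (ℕ × ℕ))

namespace SkolemMatrix

/-- The values of the `b`-th assignment, as arguments of a function variable. -/
noncomputable def args (V : Finset ℕ) (b : ℕ) : List (ℕ × ℕ) := (vars V).map fun v => (b, v.1)

theorem map_args {M : Type w} (V : Finset ℕ) (b : ℕ) (x : ℕ × ℕ → M) :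
    (args V b).map x = (vars V).map (res V fun v => x (b, v)) := by
  rw [args, List.map_map]
  rfl

/-- The `b`-th assignment belongs to the team coded by the function variables `p (here 0)` and
`p (here 1)`. -/
noncomputable def mem (V : Finset ℕ) (p : Idx → Idx) (b : ℕ) : SkolemMatrix L :=
  .veq (.inr (p (.here 0), args V b)) (.inr (p (.here 1), args V b))

@[simp] theorem sat_mem {M : Type w} [L.Structure M] (V : Finset ℕ) (p : Idx → Idx) (b : ℕ)
    (G : Idx → List M → M) (x : ℕ × ℕ → M) :
    (mem (L := L) V p b).Sat (leafVal G x) ↔ res V (fun v => x (b, v)) ∈ teamOf V (G ∘ p) := by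
  simp [mem, map_args, teamOf]

/-- The assignments `b` and `c` agree on the given variables. -/
def agree (l : List ℕ) (b c : ℕ) : List (SkolemMatrix L) :=
  l.map fun v => .veq (.inl (b, v)) (.inl (c, v))

@[simp] theorem forall_sat_agree {M : Type w} [L.Structure M] (l : List ℕ) (b c : ℕ)
    (G : Idx → List M → M) (x : ℕ × ℕ → M) :
    (∀ χ ∈ agree (L := L) l b c, χ.Sat (leafVal G x)) ↔ ∀ v ∈ l, x (b, v) = x (c, v) := by
  simp [agree]

/-- Equivalence. -/
def iff (φ ψ : SkolemMatrix L) : SkolemMatrix L := (φ.imp ψ).and (ψ.imp φ)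

@[simp] theorem sat_iff {M : Type w} [L.Structure M] (φ ψ : SkolemMatrix L)
    (val : Leaf Idx (ℕ × ℕ) → M) : (iff φ ψ).Sat val ↔ (φ.Sat val ↔ ψ.Sat val) := by
  simp [iff, iff_def]

/-- Disjunction. -/
def or (φ ψ : SkolemMatrix L) : SkolemMatrix L := φ.not.imp ψ

@[simp] theorem sat_or {M : Type w} [L.Structure M] (φ ψ : SkolemMatrix L)
    (val : Leaf Idx (ℕ × ℕ) → M) : (or φ ψ).Sat val ↔ (φ.Sat val ∨ ψ.Sat val) := by
  simp [or, or_iff_not_imp_left]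

/-- The translation of an immediate subformula. -/
def child (p : Idx → Idx) (θ : SkolemMatrix L) : SkolemMatrix L := θ.relabel (leafMap p id)

@[simp] theorem sat_child {M : Type w} [L.Structure M] (p : Idx → Idx) (θ : SkolemMatrix L)
    (G : Idx → List M → M) (x : ℕ × ℕ → M) :
    (child p θ).Sat (leafVal G x) ↔ θ.Sat (leafVal (G ∘ p) x) := by
  simp [child, leafVal_comp_leafMap]

/-- Every assignment in the team satisfies `ℓ`. -/
noncomputable def flat {V : Finset ℕ} (l : QFree L V) : SkolemMatrix L :=
  (mem V id 0).imp (l.relabel fun v => .inl (0, v.1))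

/-- The team of the subformula arises by `Team.extend` from that of the formula, where `q` says
which values of the variable `x` of assignment `1` are allowed for assignment `0`. -/
noncomputable def quant (V : Finset ℕ) (x : ℕ) (q : List (SkolemMatrix L)) : SkolemMatrix L :=
  (agree (V.toList.filter (· ≠ x)) 0 1).foldr .imp
    (((mem V id 0).imp (q.foldr .imp (mem (insert x V) .left 1))).and
      ((mem (insert x V) .left 1).imp
        (.imp (.veq (.inl (0, x)) (.inr (.here 3, args (insert x V) 1)))
          (q.foldr .and (mem V id 0)))))

/-- The independence atom: assignment `2` has the values required of the assignment that the atom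
postulates for the assignments `0` and `1`, if its values are those of the Skolem functions. -/
noncomputable def indep {V : Finset ℕ} (a : IndepAtom V) : SkolemMatrix L :=
  ((vars V).map fun v =>
      .veq (.inl (2, v.1)) (.inr (.here (v.1 + 2), args V 0 ++ args V 1))).foldr .imp <|
    (mem V id 0).imp <| (mem V id 1).imp <| (agree (a.xs.map Subtype.val) 0 1).foldr .imp <|
      (agree (a.xs.map Subtype.val) 2 0 ++ agree (a.ys.map Subtype.val) 2 0 ++
        agree (a.zs.map Subtype.val) 2 1).foldr .and (mem V id 2)

end SkolemMatrix

open SkolemMatrix in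
/-- The matrix of the existential second-order translation of a formula: it relates a code of a
team to codes of teams for all subformulas.  The function variables `here 0` and `here 1` code the
team of the formula itself.  For quantifiers, `here 2` is the choice function of `∃`, and `here 3`
recovers the overwritten value of the quantified variable.  For an independence atom,
`here (v + 2)` gives the value of `v` under the postulated assignment. -/
noncomputable def Formula.toMatrix : ∀ {V : Finset ℕ}, Formula L IndepAtom V → SkolemMatrix L
  | _, .eq t₁ t₂ => flat (.eq t₁ t₂)
  | _, .neq t₁ t₂ => flat (.not (.eq t₁ t₂))
  | _, .rel R ts => flat (.rel R ts)
  | _, .nrel R ts => flat (.not (.rel R ts))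
  | _, .atom a => indep a
  | V, .natom _ => (mem V id 0).not
  | V, .and φ ψ => .and (.and (iff (mem V id 0) (mem V .left 0)) (child .left φ.toMatrix))
      (.and (iff (mem V id 0) (mem V .right 0)) (child .right ψ.toMatrix))
  | V, .or φ ψ => .and (iff (mem V id 0) (SkolemMatrix.or (mem V .left 0) (mem V .right 0)))
      (.and (child .left φ.toMatrix) (child .right ψ.toMatrix))
  | V, .ex x φ => .and (quant V x [.veq (.inl (1, x)) (.inr (.here 2, args V 0))])
      (child .left φ.toMatrix)
  | V, .all x φ => .and (quant V x []) (child .left φ.toMatrix)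

section

variable {M : Type w} [L.Structure M]

/-- Choosing three assignments is choosing a value for each first-order variable of a matrix. -/
theorem forall_assignments {P : (ℕ → M) → (ℕ → M) → (ℕ → M) → Prop} :
    (∀ x : ℕ × ℕ → M, P (fun v => x (0, v)) (fun v => x (1, v)) fun v => x (2, v)) ↔
      ∀ t₀ t₁ t₂, P t₀ t₁ t₂ :=
  ⟨fun h t₀ t₁ t₂ => by
    simpa using h fun p => if p.1 = 0 then t₀ p.2 else if p.1 = 1 then t₁ p.2 else t₂ p.2,
    fun h _ => h _ _ _⟩

theorem forall_sat_and (φ ψ : SkolemMatrix L) (G : Idx → List M → M) :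
    (∀ x, (φ.and ψ).Sat (leafVal G x)) ↔
      (∀ x, φ.Sat (leafVal G x)) ∧ ∀ x, ψ.Sat (leafVal G x) :=
  forall_and

theorem forall_sat_flat [Nonempty M] {V : Finset ℕ} (l : QFree L V) (G : Idx → List M → M) :
    (∀ x, (SkolemMatrix.flat l).Sat (leafVal G x)) ↔ ∀ s ∈ teamOf V G, l.Sat s := by
  have : (∀ x, (SkolemMatrix.flat l).Sat (leafVal G x)) ↔
      ∀ t : ℕ → M, res V t ∈ teamOf V G → l.Sat (res V t) := by
    simp only [SkolemMatrix.flat, QFree.sat_imp, SkolemMatrix.sat_mem, QFree.sat_relabel]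
    exact (forall_assignments
      (P := fun t _ _ => res V t ∈ teamOf V G → l.Sat (res V t))).trans (by simp)
  rw [this]
  refine ⟨fun h s hs => ?_, fun h t => h _⟩
  obtain ⟨t, rfl⟩ := exists_res_eq s
  exact h t hs

theorem forall_sat_iff_mem [Nonempty M] {V : Finset ℕ} (G : Idx → List M → M)
    {X : Team V M} :
    (∀ x : ℕ × ℕ → M, res V (fun v => x (0, v)) ∈ teamOf V G ↔ res V (fun v => x (0, v)) ∈ X) ↔
      teamOf V G = X :=
  (forall_assignments (P := fun t _ _ => res V t ∈ teamOf V G ↔ res V t ∈ X)).trans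
    (by simp [team_ext_res])

theorem forall_sat_quant [Nonempty M] {V : Finset ℕ} (x : ℕ) (q : List (SkolemMatrix L))
    (Q : (V → M) → M → Prop) (G : Idx → List M → M)
    (hq : ∀ z, (∀ χ ∈ q, χ.Sat (leafVal G z)) ↔ Q (res V fun v => z (0, v)) (z (1, x))) :
    (∀ z, (SkolemMatrix.quant V x q).Sat (leafVal G z)) ↔ ∀ t t' : ℕ → M,
      (∀ v ∈ V, v ≠ x → t v = t' v) →
        (res V t ∈ teamOf V G → Q (res V t) (t' x) →
          res _ t' ∈ teamOf (insert x V) (G ∘ .left)) ∧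
        (res _ t' ∈ teamOf (insert x V) (G ∘ .left) →
          t x = G (.here 3) ((vars (insert x V)).map (res _ t')) →
            res V t ∈ teamOf V G ∧ Q (res V t) (t' x)) := by
  have := forall_assignments (M := M) (P := fun t t' _ => (∀ v ∈ V, v ≠ x → t v = t' v) →
        (res V t ∈ teamOf V G → Q (res V t) (t' x) →
          res _ t' ∈ teamOf (insert x V) (G ∘ .left)) ∧
        (res _ t' ∈ teamOf (insert x V) (G ∘ .left) →
          t x = G (.here 3) ((vars (insert x V)).map (res _ t')) →
            res V t ∈ teamOf V G ∧ Q (res V t) (t' x)))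
  refine Iff.trans (forall_congr' fun z => ?_) (this.trans (by simp))
  have hag : (∀ v ∈ V.toList.filter (· ≠ x), z (0, v) = z (1, v)) ↔
      ∀ v ∈ V, v ≠ x → z (0, v) = z (1, v) := by simp [imp.swap]
  simp only [SkolemMatrix.quant, QFree.sat_foldr_imp, QFree.sat_foldr_and, QFree.sat_and,
    QFree.sat_imp, SkolemMatrix.forall_sat_agree, hag, SkolemMatrix.sat_mem, hq, QFree.sat_veq, leafVal_inl,
    leafVal_inr, SkolemMatrix.map_args, Function.comp_id]
  simp [and_comm]

theorem forall_sat_indep {V : Finset ℕ} (a : IndepAtom V) (G : Idx → List M → M) :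
    (∀ z, (SkolemMatrix.indep (L := L) a).Sat (leafVal G z)) ↔ ∀ t₀ t₁ t₂ : ℕ → M,
      (∀ v ∈ V, t₂ v = G (.here (v + 2)) ((vars V).map (res V t₀) ++ (vars V).map (res V t₁))) →
      res V t₀ ∈ teamOf V G → res V t₁ ∈ teamOf V G →
      a.xs.map (res V t₀) = a.xs.map (res V t₁) →
        res V t₂ ∈ teamOf V G ∧ a.xs.map (res V t₂) = a.xs.map (res V t₀) ∧
          a.ys.map (res V t₂) = a.ys.map (res V t₀) ∧
          a.zs.map (res V t₂) = a.zs.map (res V t₁) := by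
  rw [← forall_assignments]
  refine forall_congr' fun z => ?_
  have key (l : List V) (b c : ℕ) :
      (∀ χ ∈ SkolemMatrix.agree (L := L) (l.map Subtype.val) b c, χ.Sat (leafVal G z)) ↔
        l.map (res V fun v => z (b, v)) = l.map (res V fun v => z (c, v)) := by
    simp [List.map_inj_left, res]
  simp only [SkolemMatrix.indep, QFree.sat_foldr_imp, QFree.sat_foldr_and, QFree.sat_imp, key,
    List.forall_mem_append, SkolemMatrix.sat_mem, List.forall_mem_map, QFree.sat_veq, leafVal_inl,
    leafVal_inr, List.map_append, SkolemMatrix.map_args, Function.comp_id]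
  simp [mem_vars, and_comm, and_left_comm, and_assoc]

/-- On domains with at least two elements, team semantics of independence logic is existential
second-order. -/
theorem Formula.sat_iff_exists_matrix [Nontrivial M] {V : Finset ℕ} (φ : Formula L IndepAtom V)
    (X : Team V M) :
    φ.Sat IndepAtom.Sat X ↔
      ∃ G : Idx → List M → M, teamOf V G = X ∧ ∀ x, φ.toMatrix.Sat (leafVal G x) := by
  have flat {V : Finset ℕ} (l : QFree L V) (X : Team V M) : (∀ s ∈ X, l.Sat s) ↔
      ∃ G : Idx → List M → M, teamOf V G = X ∧ ∀ x, (SkolemMatrix.flat l).Sat (leafVal G x) := by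
    simp only [forall_sat_flat]
    constructor
    · intro h
      obtain ⟨e₀, e₁, he⟩ := exists_code X
      let g : ℕ → List M → M := fun | 0 => e₀ | _ => e₁
      have hX : teamOf V (Idx.combine g (fun _ => e₀) fun _ => e₀) = X := Set.ext he
      exact ⟨_, hX, hX ▸ h⟩
    · rintro ⟨G, rfl, h⟩
      exact h
  induction φ with
  | eq t₁ t₂ => exact flat (.eq t₁ t₂) X
  | neq t₁ t₂ => exact flat (.not (.eq t₁ t₂)) X
  | rel R ts => exact flat (.rel R ts) X
  | nrel R ts => exact flat (.not (.rel R ts)) X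
  | @atom V a =>
    simp only [Formula.toMatrix, forall_sat_indep, Formula.Sat]
    constructor
    · intro h
      have (s s' : V → M) : ∃ s'', s ∈ X → s' ∈ X → a.xs.map s = a.xs.map s' →
          s'' ∈ X ∧ a.xs.map s'' = a.xs.map s ∧ a.ys.map s'' = a.ys.map s ∧
            a.zs.map s'' = a.zs.map s' := by
        by_cases hc : s ∈ X ∧ s' ∈ X ∧ a.xs.map s = a.xs.map s'
        · obtain ⟨s'', hs''⟩ := h s hc.1 s' hc.2.1 hc.2.2
          exact ⟨s'', fun _ _ _ => hs''⟩
        · exact ⟨s, fun h₁ h₂ h₃ => absurd ⟨h₁, h₂, h₃⟩ hc⟩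
      choose S hS using this
      choose f hf using fun v : V => exists_forall_map_vars_append fun s s' => S s s' v
      obtain ⟨e₀, e₁, he⟩ := exists_code X
      classical
      let g : ℕ → List M → M := fun
        | 0 => e₀
        | 1 => e₁
        | v + 2 => if h : v ∈ V then f ⟨v, h⟩ else e₀
      have hX : teamOf V (Idx.combine g (fun _ => e₀) fun _ => e₀) = X := Set.ext he
      refine ⟨_, hX, fun t₀ t₁ t₂ h₂ => ?_⟩
      have : res V t₂ = S (res V t₀) (res V t₁) := funext fun v => by
        have := h₂ v v.2
        simp only [Idx.combine, g, v.2, dif_pos, hf] at this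
        exact this
      rw [hX, this]
      exact hS _ _
    · rintro ⟨G, rfl, h⟩ s hs s' hs' hss'
      obtain ⟨t₀, rfl⟩ := exists_res_eq s
      obtain ⟨t₁, rfl⟩ := exists_res_eq s'
      exact ⟨_, h t₀ t₁ (fun v =>
        G (.here (v + 2)) ((vars V).map (res V t₀) ++ (vars V).map (res V t₁)))
        (fun _ _ => rfl) hs hs' hss'⟩
  | @natom V a =>
    have hempty (G : Idx → List M → M) := forall_sat_iff_mem G (X := (∅ : Team V M))
    simp only [Set.mem_empty_iff_false, iff_false] at hempty
    simp only [Formula.toMatrix, Formula.Sat, QFree.sat_not, SkolemMatrix.sat_mem, Function.comp_id,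
      hempty]
    constructor
    · rintro rfl
      obtain ⟨e₀, e₁, he⟩ := exists_code (∅ : Team V M)
      let g : ℕ → List M → M := fun | 0 => e₀ | _ => e₁
      have hX : teamOf V (Idx.combine g (fun _ => e₀) fun _ => e₀) = ∅ := Set.ext he
      exact ⟨_, hX, hX⟩
    · rintro ⟨G, rfl, h⟩
      exact h
  | @and V φ ψ ih₁ ih₂ =>
    simp only [Formula.toMatrix, Formula.Sat, forall_sat_and, SkolemMatrix.sat_iff,
      SkolemMatrix.sat_mem, SkolemMatrix.sat_child, Function.comp_id, forall_sat_iff_mem, ih₁, ih₂]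
    constructor
    · rintro ⟨⟨G₁, hX₁, h₁⟩, G₂, hX₂, h₂⟩
      obtain ⟨e₀, e₁, he⟩ := exists_code X
      let g : ℕ → List M → M := fun | 0 => e₀ | _ => e₁
      have hX : teamOf V (Idx.combine g G₁ G₂) = X := Set.ext he
      exact ⟨_, hX, ⟨hX.trans hX₁.symm, h₁⟩, hX.trans hX₂.symm, h₂⟩
    · rintro ⟨G, rfl, ⟨hX₁, h₁⟩, hX₂, h₂⟩
      exact ⟨⟨_, hX₁.symm, h₁⟩, _, hX₂.symm, h₂⟩
  | @or V φ ψ ih₁ ih₂ =>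
    simp only [Formula.toMatrix, Formula.Sat, forall_sat_and, SkolemMatrix.sat_iff,
      SkolemMatrix.sat_or, SkolemMatrix.sat_mem, SkolemMatrix.sat_child, Function.comp_id, ← Set.mem_union,
      forall_sat_iff_mem, ih₁, ih₂]
    constructor
    · rintro ⟨_, _, rfl, ⟨G₁, rfl, h₁⟩, G₂, rfl, h₂⟩
      obtain ⟨e₀, e₁, he⟩ := exists_code (teamOf V G₁ ∪ teamOf V G₂)
      let g : ℕ → List M → M := fun | 0 => e₀ | _ => e₁
      have hX : teamOf V (Idx.combine g G₁ G₂) = teamOf V G₁ ∪ teamOf V G₂ := Set.ext he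
      exact ⟨_, hX, hX, h₁, h₂⟩
    · rintro ⟨G, rfl, hX, h₁, h₂⟩
      exact ⟨_, _, hX, ⟨_, rfl, h₁⟩, _, rfl, h₂⟩
  | @ex V x φ ih =>
    have hq (G : Idx → List M → M) (z : ℕ × ℕ → M) :
        (∀ χ ∈ ([.veq (.inl (1, x)) (.inr (.here 2, SkolemMatrix.args V 0))] :
            List (SkolemMatrix L)),
          χ.Sat (leafVal G z)) ↔
        z (1, x) = G (.here 2) ((vars V).map (res V fun v => z (0, v))) := by
      simp [SkolemMatrix.map_args]
    have hquant (G : Idx → List M → M) :=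
      forall_sat_quant x _ (fun s a => a = G (.here 2) ((vars V).map s)) G (hq G)
    simp only [Formula.toMatrix, Formula.Sat, forall_sat_and, SkolemMatrix.sat_child, ih,
      hquant]
    constructor
    · rintro ⟨F, G₁, hX₁, h₁⟩
      classical
      -- Values of the choice function outside `X` do not affect the supplemented team.
      let F' : (V → M) → M := fun s =>
        if h : s ∈ X then F ⟨s, h⟩ else Classical.arbitrary M
      have hF : F = fun s : X => F' s := funext fun s => by simp [F']
      rw [hF, Team.supplement_eq_extend] at hX₁
      obtain ⟨H, hH⟩ := Team.eq_extend_iff.1 hX₁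
      obtain ⟨e₀, e₁, he⟩ := exists_code X
      obtain ⟨f, hf⟩ := exists_forall_map_vars F'
      obtain ⟨k, hk⟩ := exists_forall_map_vars H
      let g : ℕ → List M → M := fun | 0 => e₀ | 1 => e₁ | 2 => f | _ => k
      have hX : teamOf V (Idx.combine g G₁ G₁) = X := Set.ext he
      refine ⟨_, hX, fun t t' hag => ?_, h₁⟩
      rw [hX]
      simpa only [Idx.combine_comp_left, Idx.combine, g, hf, hk] using hH t t' hag
    · rintro ⟨G, rfl, hq, h₁⟩
      refine ⟨fun s => G (.here 2) ((vars V).map s.1), _, ?_, h₁⟩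
      rw [Team.supplement_eq_extend (F := fun s => G (.here 2) ((vars V).map s))]
      exact Team.eq_extend_iff.2 ⟨fun s' => G (.here 3) ((vars _).map s'), hq⟩
  | @all V x φ ih =>
    have hquant (G : Idx → List M → M) :=
      forall_sat_quant (L := L) x [] (fun (_ : V → M) _ => True) G (by simp)
    simp only [Formula.toMatrix, Formula.Sat, forall_sat_and, SkolemMatrix.sat_child, ih, hquant,
      Team.duplicate_eq_extend]
    constructor
    · rintro ⟨G₁, hX₁, h₁⟩
      obtain ⟨H, hH⟩ := Team.eq_extend_iff.1 hX₁
      obtain ⟨e₀, e₁, he⟩ := exists_code X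
      obtain ⟨k, hk⟩ := exists_forall_map_vars H
      let g : ℕ → List M → M := fun | 0 => e₀ | 1 => e₁ | _ => k
      have hX : teamOf V (Idx.combine g G₁ G₁) = X := Set.ext he
      refine ⟨_, hX, fun t t' hag => ?_, h₁⟩
      rw [hX]
      simpa only [Idx.combine_comp_left, Idx.combine, g, hk] using hH t t' hag
    · rintro ⟨G, rfl, hq, h₁⟩
      exact ⟨_, Team.eq_extend_iff.2 ⟨fun s' => G (.here 3) ((vars _).map s'), hq⟩, h₁⟩

end

end Translation

/-! ### Sentences -/

section Sentences

variable {L : FirstOrder.Language.{u, v}}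

/-- On a domain with one element, independence atoms and dependence atoms are always true. -/
theorem Formula.sat_mapAtom_of_subsingleton {M : Type w} [L.Structure M] [Subsingleton M]
    {V : Finset ℕ} (φ : Formula L IndepAtom V) (X : Team V M) :
    (φ.mapAtom fun {V} _ => (⟨[], []⟩ : DepAtom V)).Sat DepAtom.Sat X ↔
      φ.Sat IndepAtom.Sat X := by
  refine φ.sat_mapAtom _ (fun a X => ?_) X
  simp only [DepAtom.Sat, IndepAtom.Sat, List.map_nil, implies_true, true_iff]
  exact fun s hs s' _ _ => ⟨s, hs, rfl, rfl, by rw [Subsingleton.elim s' s]⟩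

/-- A sentence of dependence logic true exactly in the structures with one element. -/
theorem exists_depSentence_subsingleton (L : FirstOrder.Language.{u, v}) :
    ∃ ψ : DepSentence L, ∀ (M : Type w) [L.Structure M] [Nonempty M],
      DepSentence.Models M ψ ↔ Subsingleton M := by
  obtain ⟨ψ, hψ⟩ := exists_depSentence.{u, v, w} (L := L) (ι := Empty) (κ := Bool)
    (.veq (.inl true) (.inl false))
  refine ⟨ψ, fun M _ _ => (hψ M).trans ⟨fun ⟨G, hG⟩ => ⟨fun a b => ?_⟩, fun _ => ?_⟩⟩
  · simpa using hG fun i => cond i a b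
  · exact ⟨Empty.elim, fun x => Subsingleton.elim _ _⟩

theorem teamOf_empty_eq_singleton {M : Type w} [Nonempty M] (G : Idx → List M → M) :
    teamOf ∅ G = {emptyAssignment M} ↔ ∀ t, res ∅ t ∈ teamOf ∅ G := by
  have (s : (∅ : Finset ℕ) → M) : s = emptyAssignment M :=
    funext fun y => absurd y.2 (Finset.notMem_empty _)
  simp [team_ext_res, this]

/-- Over structures with at least two elements, each sentence of independence logic has an
equivalent in dependence logic, which can be taken false in one-element structures. -/
theorem IndepSentence.exists_depSentence_nontrivial (φ : IndepSentence L) :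
    ∃ ψ : DepSentence L, ∀ (M : Type w) [L.Structure M] [Nonempty M],
      DepSentence.Models M ψ ↔ Nontrivial M ∧ IndepSentence.Models M φ := by
  obtain ⟨ψ, hψ⟩ := exists_depSentence.{u, v, w} (L := L)
    (.and (.not (.veq (.inr (.here 0, [])) (.inr (.here 1, []))))
      (.and (SkolemMatrix.mem ∅ .left 0) (SkolemMatrix.child .left φ.toMatrix)))
  refine ⟨ψ, fun M _ _ => (hψ M).trans ?_⟩
  have hmem (G : Idx → List M → M) :
      (∀ x, (SkolemMatrix.mem (L := L) ∅ .left 0).Sat (leafVal G x)) ↔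
        teamOf ∅ (G ∘ .left) = {emptyAssignment M} := by
    rw [teamOf_empty_eq_singleton]
    simp only [SkolemMatrix.sat_mem]
    exact (forall_assignments (P := fun t _ _ => res ∅ t ∈ teamOf ∅ (G ∘ .left))).trans (by simp)
  simp only [forall_sat_and, hmem, SkolemMatrix.sat_child, QFree.sat_not, QFree.sat_veq,
    leafVal_inr, List.map_nil, forall_const]
  constructor
  · rintro ⟨G, hne, hX, h⟩
    have : Nontrivial M := ⟨_, _, hne⟩
    exact ⟨this, (φ.sat_iff_exists_matrix _).2 ⟨_, hX, h⟩⟩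
  · rintro ⟨_, h⟩
    obtain ⟨G, hX, hG⟩ := (φ.sat_iff_exists_matrix _).1 h
    obtain ⟨a, b, hab⟩ := exists_pair_ne M
    exact ⟨Idx.combine (fun k _ => if k = 0 then a else b) G G, by simpa [Idx.combine] using hab,
      hX, hG⟩

theorem DepSentence.models_and {M : Type w} [L.Structure M] (φ ψ : DepSentence L) :
    DepSentence.Models M (.and φ ψ) ↔ DepSentence.Models M φ ∧ DepSentence.Models M ψ := Iff.rfl

/-- Disjunction of sentences of dependence logic is classical, because the empty team satisfies
every formula. -/
theorem DepSentence.models_or {M : Type w} [L.Structure M] [Nonempty M] (φ ψ : DepSentence L) :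
    DepSentence.Models M (.or φ ψ) ↔ DepSentence.Models M φ ∨ DepSentence.Models M ψ := by
  constructor
  · rintro ⟨Y, Z, h, hY, hZ⟩
    rcases Set.subset_singleton_iff_eq.1 (h ▸ Set.subset_union_left : Y ⊆ _) with rfl | rfl
    · rw [Set.empty_union] at h
      subst h
      exact .inr hZ
    · exact .inl hY
  · rintro (h | h)
    · exact ⟨_, ∅, (Set.union_empty _).symm, h, ψ.sat_empty⟩
    · exact ⟨∅, _, (Set.empty_union _).symm, φ.sat_empty, h⟩

theorem IndepSentence.exists_depSentence (φ : IndepSentence L) :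
    ∃ ψ : DepSentence L, ∀ (M : Type w) [L.Structure M] [Nonempty M],
      IndepSentence.Models M φ ↔ DepSentence.Models M ψ := by
  obtain ⟨ψ₁, h₁⟩ := exists_depSentence_subsingleton.{u, v, w} L
  obtain ⟨ψ₂, h₂⟩ := φ.exists_depSentence_nontrivial
  refine ⟨.or (.and ψ₁ (φ.mapAtom fun _ => ⟨[], []⟩)) ψ₂, fun M _ _ => ?_⟩
  rw [DepSentence.models_or, DepSentence.models_and, h₁, h₂]
  rcases subsingleton_or_nontrivial M with hM | hM
  · have : DepSentence.Models M (φ.mapAtom fun _ => ⟨[], []⟩) ↔ IndepSentence.Models M φ :=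
      φ.sat_mapAtom_of_subsingleton _
    simp [this, hM, not_nontrivial M]
  · simp [hM, not_subsingleton M]

/-- The dependence atom `=(ys, xs)` is the independence atom `xs ⊥_{ys} xs`. -/
theorem DepSentence.exists_indepSentence (ψ : DepSentence L) :
    ∃ φ : IndepSentence L, ∀ (M : Type w) [L.Structure M],
      DepSentence.Models M ψ ↔ IndepSentence.Models M φ := by
  refine ⟨ψ.mapAtom fun a => ⟨a.xs, a.ys, a.xs⟩, fun M _ => (ψ.sat_mapAtom _ ?_ _).symm⟩
  intro V a X
  constructor
  · intro h s hs s' hs' hss'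
    obtain ⟨s'', _, _, h₁, h₂⟩ := h s hs s' hs' hss'
    exact h₁.symm.trans h₂
  · intro h s hs s' hs' hss'
    exact ⟨s, hs, rfl, rfl, h s hs s' hs' hss'⟩

end Sentences

end TeamLogic

theorem corollary15 (L : FirstOrder.Language.{u, v}) :
    (∀ φ : TeamLogic.IndepSentence L, ∃ ψ : TeamLogic.DepSentence L,
      ∀ (M : Type w) [L.Structure M] [Nonempty M],
        TeamLogic.IndepSentence.Models M φ ↔ TeamLogic.DepSentence.Models M ψ) ∧
    (∀ ψ : TeamLogic.DepSentence L, ∃ φ : TeamLogic.IndepSentence L,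
      ∀ (M : Type w) [L.Structure M] [Nonempty M],
        TeamLogic.DepSentence.Models M ψ ↔ TeamLogic.IndepSentence.Models M φ) := by
  refine ⟨fun φ => φ.exists_depSentence, fun ψ => ?_⟩
  obtain ⟨φ, hφ⟩ := TeamLogic.DepSentence.exists_indepSentence.{u, v, w} ψ
  exact ⟨φ, fun M _ _ => hφ M⟩
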